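/- Conventions. Let $\mathbb N^{\mathbb N}$ be the Baire space (with the product topology, $\mathbb N$ being discrete; it is homeomorphic to the space of irrational numbers), let $\mathfrak c=2^{\aleph_0}$, and let $\mathrm{cov}(\mathcal M)$ be the least cardinality of a family of meager subsets of $\mathbb N^{\mathbb N}$ whose union is $\mathbb N^{\mathbb N}$. A *Lusin set* means here a $\mathfrak c$-Lusin set: a set $L\subseteq\mathbb N^{\mathbb N}$ with $|L|=\mathfrak c$ and $|L\cap M|<\mathfrak c$ for every meager $M\subseteq\mathbb N^{\mathbb N}$ (under CH this is the classical notion). Let $X$ be an infinite topological space. A cover of $X$ is a family $\mathcal U$ of subsets of $X$ with $\bigcup\mathcal U=X$ and $X\notin\mathcal U$. The cover $\mathcal U$ is - an *$\omega$-cover* if every finite subset of $X$ is contained in some member of $\mathcal U$; - a *$\gamma$-cover* if $\mathcal U$ is infinite and each $x\in X$ belongs to all but finitely many members of $\mathcal U$; - a *$\tau$-cover* if each $x\in X$ belongs to infinitely many members of $\mathcal U$ and, for all $x,y\in X$, either ($x\in U\Rightarrow y\in U$) for all but finitely many $U\in\mathcal U$, or ($y\in U\Rightarrow x\in U$) for all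 but finitely many $U\in\mathcal U$. Let $\mathcal B_\Omega$, $\Gamma$ and $\mathrm T$ be the collections of all countable Borel $\omega$-covers, countable open $\gamma$-covers and countable open $\tau$-covers of $X$, respectively. For collections $\mathfrak U,\mathfrak V$ of covers of $X$: - $X$ satisfies $\mathsf S_1(\mathfrak U,\mathfrak V)$ if for each sequence $(\mathcal U_n)_{n\in\mathbb N}$ of members of $\mathfrak U$ there are $V_n\in\mathcal U_n$ ($n\in\mathbb N$) with $\{V_n:n\in\mathbb N\}\in\mathfrak V$; - $X$ satisfies $\mathsf U_{fin}(\mathfrak U,\mathfrak V)$ if for each sequence $(\mathcal U_n)_{n\in\mathbb N}$ of members of $\mathfrak U$, none of which contains a finite subcover, there are finite (possibly empty) sets $\mathcal F_n\subseteq\mathcal U_n$ ($n\in\mathbb N$) with $\{\bigcup\mathcal F_n:n\in\mathbb N\}\in\mathfrak V$. **Theorem.** If $\mathrm{cov}(\mathcal M)=\mathfrak c$, then there exists a Lusin set $L\subseteq\mathbb N^{\mathbb N}$ which, as a subspace of $\mathbb N^{\mathbb N}$, satisfies $\mathsf S_1(\mathcal B_\Omega,\mathcal B_\Omega)$ but does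 not satisfy $\mathsf U_{fin}(\Gamma,\mathrm T)$. -/

import Mathlib

namespace SelectionPrinciples

universe u

/-- The covering number of the ideal of meager subsets of `X`: the least cardinality of a family
of meager sets whose union is `X`. -/
noncomputable def covMeager (X : Type u) [TopologicalSpace X] : Cardinal.{u} :=
  sInf {κ : Cardinal.{u} | ∃ 𝓜 : Set (Set X),
    (∀ M ∈ 𝓜, IsMeagre M) ∧ ⋃₀ 𝓜 = Set.univ ∧ Cardinal.mk 𝓜 = κ}

/-- `L` is a `κ`-Lusin subset of `X`: it has at least `κ` points, but meets every meager set in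
fewer than `κ` points. -/
def IsLusin {X : Type u} [TopologicalSpace X] (κ : Cardinal.{u}) (L : Set X) : Prop :=
  κ ≤ Cardinal.mk L ∧ ∀ M : Set X, IsMeagre M → Cardinal.mk ↥(L ∩ M) < κ

/-- A cover of the space `X`, by convention not containing `X` itself as an element. -/
def IsCover {X : Type u} (U : Set (Set X)) : Prop :=
  ⋃₀ U = Set.univ ∧ Set.univ ∉ U

/-- An `ω`-cover: every finite subset of `X` is contained in a single member. -/
def IsOmegaCover {X : Type u} (U : Set (Set X)) : Prop :=
  IsCover U ∧ ∀ F : Set X, F.Finite → ∃ V ∈ U, F ⊆ V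

/-- A `γ`-cover: infinite, and every point belongs to all but finitely many members. -/
def IsGammaCover {X : Type u} (U : Set (Set X)) : Prop :=
  IsCover U ∧ U.Infinite ∧ ∀ x : X, {V ∈ U | x ∉ V}.Finite

/-- A large cover: every point belongs to infinitely many members. -/
def IsLargeCover {X : Type u} (U : Set (Set X)) : Prop :=
  IsCover U ∧ ∀ x : X, {V ∈ U | x ∈ V}.Infinite

/-- A `τ`-cover: a large cover such that for all points `x, y`, either `x ∈ V → y ∈ V` for all
but finitely many members `V`, or `y ∈ V → x ∈ V` for all but finitely many members `V`. -/
def IsTauCover {X : Type u} (U : Set (Set X)) : Prop :=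
  IsLargeCover U ∧
    ∀ x y : X, {V ∈ U | ¬ (x ∈ V → y ∈ V)}.Finite ∨ {V ∈ U | ¬ (y ∈ V → x ∈ V)}.Finite

/-- The collection `B_Ω` of countable Borel `ω`-covers of `X`. -/
def BorelOmega (X : Type u) [TopologicalSpace X] : Set (Set (Set X)) :=
  {U | U.Countable ∧ (∀ V ∈ U, @MeasurableSet X (borel X) V) ∧ IsOmegaCover U}

/-- The collection `Γ` of countable open `γ`-covers of `X`. -/
def OpenGamma (X : Type u) [TopologicalSpace X] : Set (Set (Set X)) :=
  {U | U.Countable ∧ (∀ V ∈ U, IsOpen V) ∧ IsGammaCover U}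

/-- The collection `T` of countable open `τ`-covers of `X`. -/
def OpenTau (X : Type u) [TopologicalSpace X] : Set (Set (Set X)) :=
  {U | U.Countable ∧ (∀ V ∈ U, IsOpen V) ∧ IsTauCover U}

/-- The selection principle `S₁(𝔘, 𝔙)`. -/
def S1 {X : Type u} (𝔘 𝔙 : Set (Set (Set X))) : Prop :=
  ∀ U : ℕ → Set (Set X), (∀ n, U n ∈ 𝔘) →
    ∃ V : ℕ → Set X, (∀ n, V n ∈ U n) ∧ Set.range V ∈ 𝔙

/-- The selection principle `U_fin(𝔘, 𝔙)`, for sequences of members of `𝔘` which do not contain a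
finite subcover. -/
def Ufin {X : Type u} (𝔘 𝔙 : Set (Set (Set X))) : Prop :=
  ∀ U : ℕ → Set (Set X), (∀ n, U n ∈ 𝔘) →
    (∀ n, ∀ F : Set (Set X), F ⊆ U n → F.Finite → ⋃₀ F ≠ Set.univ) →
    ∃ F : ℕ → Set (Set X), (∀ n, F n ⊆ U n ∧ (F n).Finite) ∧
      Set.range (fun n => ⋃₀ F n) ∈ 𝔙

end SelectionPrinciples

open Topology Filter Set TopologicalSpace
open scoped Cardinal MeasureTheory

namespace SelectionPrinciples

/-! ### Genericity in the Baire space -/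

section Residual

/-! Build `L` by recursion of length `𝔠`, each point generic over fewer than `cov(𝓜) = 𝔠`
conditions. Avoiding all meager Borel sets listed so far makes `L` Lusin; entering prescribed basic
open sets as well makes it everywhere nonmeager.

Bare ω-covers are too weak to survive the recursion, so fatness (`IsFatOver`) replaces them. A Borel
ω-cover of an everywhere nonmeager set is fat over its finite subsets; fatness passes to a generic
selector; and adding a generic point preserves it. A selector chosen at stage `b` for the earlier
points thus still works for all later ones, which gives `S₁(B_Ω, B_Ω)`.

Everywhere nonmeagerness alone refutes `U_fin(Γ, T)`: for the covers by `{x | x n < m}`, any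
selection amounts to a function `g`, and two generic points of `L` cross `g` in opposite directions
infinitely often. -/

theorem isMeagre_singleton_baire (x : ℕ → ℕ) : IsMeagre ({x} : Set (ℕ → ℕ)) := by
  refine residual_of_dense_open isClosed_singleton.isOpen_compl ?_
  rw [← interior_eq_empty_iff_dense_compl, Set.eq_empty_iff_forall_notMem]
  intro y hy
  have hyx : y ∈ ({x} : Set (ℕ → ℕ)) := interior_subset hy
  obtain rfl : y = x := hyx
  have ht : Tendsto (fun n : ℕ => Function.update y n (y n + 1)) atTop (𝓝 y) := by
    rw [tendsto_pi_nhds]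
    intro k
    refine tendsto_const_nhds.congr' ?_
    filter_upwards [eventually_gt_atTop k] with n hn
    rw [Function.update_of_ne hn.ne]
  obtain ⟨n, hn⟩ := (ht.eventually (isOpen_interior.mem_nhds hy)).exists
  have h1 : Function.update y n (y n + 1) ∈ ({y} : Set (ℕ → ℕ)) := interior_subset hn
  rw [mem_singleton_iff] at h1
  have h2 := congrFun h1 n
  simp at h2

/-- The points agreeing with `a` below `n` and with `x` from `n` on. -/
def graft (a : ℕ → ℕ) (n : ℕ) (x : ℕ → ℕ) : ℕ → ℕ := fun k => if k < n then a k else x k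

theorem continuous_graft (a : ℕ → ℕ) (n : ℕ) : Continuous (graft a n) := by
  refine continuous_pi fun k => ?_
  by_cases h : k < n
  · simpa [graft, h] using continuous_const
  · simpa [graft, h] using continuous_apply k

theorem isOpenMap_graft (a : ℕ → ℕ) (n : ℕ) : IsOpenMap (graft a n) := by
  rw [isOpenMap_iff_nhds_le]
  intro x s hs
  have hg : graft x n (graft a n x) = x := by
    funext k; by_cases h : k < n <;> simp [graft, h]
  have h1 : ∀ᶠ y in 𝓝 (graft a n x), graft x n y ∈ graft a n ⁻¹' s := by
    refine (continuous_graft x n).continuousAt.eventually ?_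
    rw [hg]; exact hs
  have h2 : ∀ᶠ y in 𝓝 (graft a n x), ∀ k ∈ Finset.range n, y k = a k := by
    rw [Filter.eventually_all_finset]
    intro k hk
    have : graft a n x k = a k := by simp [graft, Finset.mem_range.1 hk]
    have hc : ContinuousAt (fun y : ℕ → ℕ => y k) (graft a n x) := (continuous_apply k).continuousAt
    exact hc.eventually ((isOpen_discrete {a k}).mem_nhds this)
  filter_upwards [h1, h2] with y hy hya
  have hs' : graft a n (graft x n y) ∈ s := hy
  convert hs' using 1
  funext k
  by_cases h : k < n
  · simp [graft, h, hya k (Finset.mem_range.2 h)]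
  · simp [graft, h]

theorem exists_graft_mem {O : Set (ℕ → ℕ)} (hO : IsOpen O) {a : ℕ → ℕ} (ha : a ∈ O) :
    ∃ n, ∀ x, graft a n x ∈ O := by
  obtain ⟨F, u, hu, hF⟩ := isOpen_pi_iff.1 hO a ha
  refine ⟨F.sup id + 1, fun x => hF fun k hk => ?_⟩
  have : k < F.sup id + 1 := Nat.lt_succ_of_le (Finset.le_sup (f := id) hk)
  simpa [graft, this] using (hu k hk).2

/-- Fewer than `cov(𝓜)` residual properties hold simultaneously at some point of any given
nonempty open set. -/
theorem exists_mem_forall_of_residual {ι : Type} (hι : #ι < covMeager (ℕ → ℕ))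
    {p : ι → (ℕ → ℕ) → Prop} (hp : ∀ i, ∀ᶠ y in residual (ℕ → ℕ), p i y)
    {O : Set (ℕ → ℕ)} (hO : IsOpen O) (hne : O.Nonempty) : ∃ y ∈ O, ∀ i, p i y := by
  obtain ⟨a, ha⟩ := hne
  obtain ⟨n, hn⟩ := exists_graft_mem hO ha
  by_contra! hcon
  -- Otherwise the failure sets, pulled back along the continuous open map `graft a n`, would be
  -- fewer than `cov(𝓜)` meager sets covering the whole space.
  refine (hι.trans_le ?_).not_ge (Cardinal.mk_range_le (f := fun i => {x | ¬ p i (graft a n x)}))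
  refine csInf_le' ⟨_, ?_, ?_, rfl⟩
  · rintro _ ⟨i, rfl⟩
    have := tendsto_residual_of_isOpenMap (continuous_graft a n) (isOpenMap_graft a n)
    refine mem_of_superset (this.eventually (hp i)) fun x hx => ?_
    simpa using hx
  · refine Set.eq_univ_of_forall fun x => ?_
    obtain ⟨i, hi⟩ := hcon _ (hn x)
    exact ⟨_, ⟨i, rfl⟩, hi⟩

end Residual

/-! ### Fat sequences of sets -/

section Fat

variable {X : Type} [TopologicalSpace X] [SecondCountableTopology X]

/-- The sequence `V` is fat over `s`: for any finitely many basic open sets, some term of `V`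
contains `s` and is nonmeager in each of them. -/
def IsFatOver (V : ℕ → Set X) (s : Set X) : Prop :=
  ∀ O : Finset (countableBasis X), ∃ n, s ⊆ V n ∧ ∀ o ∈ O, ¬ IsMeagre (V n ∩ o.1)

/-- Fatness extends to generic points. -/
theorem IsFatOver.eventually_insert {V : ℕ → Set X} {s : Set X} (h : IsFatOver V s)
    (hV : ∀ n, MeasurableSet[borel X] (V n)) :
    ∀ᶠ y in residual X, IsFatOver V (insert y s) := by
  classical
  borelize X
  have key : ∀ O : Finset (countableBasis X), ∀ᶠ y in residual X,
      ∃ n, (s ⊆ V n ∧ ∀ o ∈ O, ¬ IsMeagre (V n ∩ o.1)) ∧ y ∈ V n := by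
    intro O
    -- By the Baire property, the complement of `G` is an open `W` modulo a meager set. If `W`
    -- contained a basic `b`, fatness for `O` together with `b` would give a piece of `G` nonmeager
    -- in `b`, a contradiction.
    set G : Set X := ⋃ n, ⋃ (_ : s ⊆ V n ∧ ∀ o ∈ O, ¬ IsMeagre (V n ∩ o.1)), V n with hG
    have hGm : MeasurableSet G :=
      MeasurableSet.iUnion fun n => MeasurableSet.iUnion fun _ => hV n
    obtain ⟨W, hW, hGW⟩ := hGm.compl.residualEq_isOpen
    rcases W.eq_empty_or_nonempty with rfl | ⟨w, hw⟩
    · filter_upwards [hGW.mem_iff] with y hy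
      have : y ∈ G := by simpa using hy
      simpa [hG] using this
    · exfalso
      obtain ⟨b, hb, -, hbW⟩ :=
        (isBasis_countableBasis X).exists_subset_of_mem_open hw hW
      obtain ⟨n, hsn, hn⟩ := h (insert ⟨b, hb⟩ O)
      refine hn _ (Finset.mem_insert_self _ _) ?_
      change _ ∈ residual X
      filter_upwards [hGW.mem_iff] with y hy hyb
      refine hy.2 (hbW hyb.2) ?_
      exact mem_iUnion₂.2 ⟨n, ⟨hsn, fun o ho => hn o (Finset.mem_insert_of_mem ho)⟩, hyb.1⟩
  filter_upwards [eventually_countable_forall.2 key] with y hy O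
  obtain ⟨n, ⟨h1, h2⟩, h3⟩ := hy O
  exact ⟨n, insert_subset h3 h1, h2⟩

/-- Fewer than `cov(𝓜)` instances of fatness of all the sequences `U n` pass to the diagonal
sequence along a suitable selector. -/
theorem exists_selector_isFatOver {ι : Type} (hι : #ι < covMeager (ℕ → ℕ))
    (hc : ℵ₀ < covMeager (ℕ → ℕ)) {S : ι → Set X}
    {U : ℕ → ℕ → Set X} (h : ∀ i n, IsFatOver (U n) (S i)) :
    ∃ f : ℕ → ℕ, ∀ i, IsFatOver (fun n => U n (f n)) (S i) := by
  have hcard : #(ι × Finset (countableBasis X)) < covMeager (ℕ → ℕ) := by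
    rw [Cardinal.mk_prod, Cardinal.lift_id, Cardinal.lift_id]
    exact Cardinal.mul_lt_of_lt hc.le hι (Cardinal.mk_le_aleph0.trans_lt hc)
  have hgen : ∀ j : ι × Finset (countableBasis X), ∀ᶠ f in residual (ℕ → ℕ),
      ∃ n, S j.1 ⊆ U n (f n) ∧ ∀ o ∈ j.2, ¬ IsMeagre (U n (f n) ∩ o.1) := by
    rintro ⟨i, O⟩
    refine residual_of_dense_open ?_ ?_
    · have : {f : ℕ → ℕ | ∃ n, S i ⊆ U n (f n) ∧ ∀ o ∈ O, ¬ IsMeagre (U n (f n) ∩ o.1)} =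
          ⋃ n, (fun f : ℕ → ℕ => f n) ⁻¹'
            {k | S i ⊆ U n k ∧ ∀ o ∈ O, ¬ IsMeagre (U n k ∩ o.1)} := by
        ext f; simp
      exact this ▸ isOpen_iUnion fun n => (isOpen_discrete _).preimage (continuous_apply n)
    · rw [dense_iff_inter_open]
      rintro W hW ⟨a, ha⟩
      obtain ⟨n, hn⟩ := exists_graft_mem hW ha
      obtain ⟨k, hk⟩ := h i n O
      refine ⟨graft a n fun _ => k, hn _, n, ?_⟩
      simpa [graft] using hk
  obtain ⟨f, -, hf⟩ := exists_mem_forall_of_residual hcard hgen isOpen_univ univ_nonempty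
  exact ⟨f, fun i O => hf (i, O)⟩

/-- The trace of `L` on every nonempty open set is nonmeager. -/
def EverywhereNonmeager (L : Set X) : Prop :=
  ∀ O : Set X, IsOpen O → O.Nonempty → ¬ IsMeagre (L ∩ O)

omit [SecondCountableTopology X] in
theorem EverywhereNonmeager.exists_mem {L : Set X} (hL : EverywhereNonmeager L) {O : Set X}
    (hO : IsOpen O) (hne : O.Nonempty) {p : X → Prop} (hp : ∀ᶠ x in residual X, p x) :
    ∃ x ∈ L, x ∈ O ∧ p x := by
  by_contra! hcon
  refine hL O hO hne ?_
  filter_upwards [hp] with x hx hxL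
  exact hcon x hxL.1 hxL.2 hx

/-- In each basic `o`, pick a point of `L` outside all the meager sets among the `U n ∩ o`. A term
containing such a point is nonmeager in `o`, so it suffices to cover `F` and finitely many of these
points. -/
theorem EverywhereNonmeager.isFatOver {L : Set X} (hL : EverywhereNonmeager L)
    {U : ℕ → Set X} (hU : ∀ F : Set X, F.Finite → F ⊆ L → ∃ n, F ⊆ U n)
    {F : Set X} (hF : F.Finite) (hFL : F ⊆ L) : IsFatOver U F := by
  intro O
  have hx : ∀ o : countableBasis X, ∃ x ∈ L, x ∈ o.1 ∧
      ∀ n, x ∈ U n ∩ o.1 → ¬ IsMeagre (U n ∩ o.1) := by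
    intro o
    refine hL.exists_mem ((isBasis_countableBasis X).isOpen o.2)
      (nonempty_of_mem_countableBasis o.2) (eventually_countable_forall.2 fun n => ?_)
    by_cases hm : IsMeagre (U n ∩ o.1)
    · filter_upwards [hm] with x hx hx'
      exact absurd hx' hx
    · exact Eventually.of_forall fun _ _ => hm
  choose x hxL hxo hxU using hx
  obtain ⟨n, hn⟩ := hU (F ∪ x '' O) (hF.union (O.finite_toSet.image _))
    (union_subset hFL (image_subset_iff.2 fun o _ => hxL o))
  exact ⟨n, subset_union_left.trans hn, fun o ho =>
    hxU o n ⟨hn (Or.inr (mem_image_of_mem x ho)), hxo o⟩⟩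

end Fat

/-! ### From fat selectors to ω-covers -/

section Selection

theorem EverywhereNonmeager.s1_borelOmega {L : Set (ℕ → ℕ)} (hL : EverywhereNonmeager L)
    (hsel : ∀ U : ℕ → ℕ → Set (ℕ → ℕ), (∀ n k, MeasurableSet[borel (ℕ → ℕ)] (U n k)) →
      (∀ F : Set (ℕ → ℕ), F.Finite → F ⊆ L → ∀ n, IsFatOver (U n) F) →
      ∃ f : ℕ → ℕ, ∀ F : Set (ℕ → ℕ), F.Finite → F ⊆ L →
        IsFatOver (fun n => U n (f n)) F) :
    S1 (BorelOmega L) (BorelOmega L) := by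
  intro 𝒰 h𝒰
  have henum : ∀ n, ∃ u : ℕ → Set L, 𝒰 n = range u := by
    intro n
    obtain ⟨hc, -, -, hω⟩ := h𝒰 n
    obtain ⟨V, hV, -⟩ := hω ∅ finite_empty
    exact hc.exists_eq_range ⟨V, hV⟩
  choose u hu using henum
  have hmem : ∀ n k, u n k ∈ 𝒰 n := fun n k => hu n ▸ mem_range_self k
  have hext : ∀ n k, ∃ W, MeasurableSet[borel (ℕ → ℕ)] W ∧ Subtype.val ⁻¹' W = u n k := by
    intro n k
    have h := (h𝒰 n).2.1 _ (hmem n k)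
    rw [instTopologicalSpaceSubtype, borel_comap] at h
    exact h
  choose W hW hWu using hext
  obtain ⟨f, hf⟩ := hsel W hW fun F hF hFL n => hL.isFatOver (fun F hF hFL => by
    obtain ⟨V, hV, hFV⟩ := (h𝒰 n).2.2.2 (Subtype.val ⁻¹' F)
      (hF.preimage Subtype.val_injective.injOn)
    rw [hu n] at hV
    obtain ⟨k, rfl⟩ := hV
    refine ⟨k, fun x hx => ?_⟩
    have : (⟨x, hFL hx⟩ : L) ∈ u n k := hFV hx
    rwa [← hWu] at this) hF hFL
  have hω : ∀ F : Set L, F.Finite → ∃ V ∈ range fun n => u n (f n), F ⊆ V := by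
    intro F hF
    -- Fatness with no open sets to meet is just the ω-cover condition.
    obtain ⟨n, hn, -⟩ := hf (Subtype.val '' F) (hF.image _) (by simp) ∅
    exact ⟨_, ⟨n, rfl⟩, (image_subset_iff.1 hn).trans (hWu n (f n)).subset⟩
  refine ⟨fun n => u n (f n), fun n => hmem _ _, countable_range _,
    forall_mem_range.2 fun n => (h𝒰 n).2.1 _ (hmem _ _), ⟨?_, ?_⟩, hω⟩
  · refine eq_univ_of_forall fun x => ?_
    obtain ⟨V, hV, hx⟩ := hω {x} (finite_singleton x)
    exact ⟨V, hV, hx rfl⟩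
  · rintro ⟨n, hn⟩
    exact (h𝒰 n).2.2.1.2 (hn ▸ hmem n (f n))

end Selection

/-! ### Failure of `U_fin(Γ, T)` -/

section NotUfin

theorem eventually_residual_frequently {A : Set ℕ} (hA : A.Infinite) {r : ℕ → ℕ → Prop}
    (hr : ∀ n, ∃ k, r n k) :
    ∀ᶠ f in residual (ℕ → ℕ), {n ∈ A | r n (f n)}.Infinite := by
  have key : ∀ N : ℕ, ∀ᶠ f in residual (ℕ → ℕ), ∃ n ∈ A, N < n ∧ r n (f n) := by
    intro N
    refine residual_of_dense_open ?_ ?_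
    · have : {f : ℕ → ℕ | ∃ n ∈ A, N < n ∧ r n (f n)} =
          ⋃ n, ⋃ (_ : n ∈ A), ⋃ (_ : N < n), (fun f : ℕ → ℕ => f n) ⁻¹' {k | r n k} := by
        ext f; simp [and_left_comm]
      rw [this]
      exact isOpen_iUnion fun n => isOpen_iUnion fun _ => isOpen_iUnion fun _ =>
        (isOpen_discrete _).preimage (continuous_apply n)
    · rw [dense_iff_inter_open]
      rintro W hW ⟨a, ha⟩
      obtain ⟨m, hm⟩ := exists_graft_mem hW ha
      obtain ⟨n, hnA, hn⟩ := hA.exists_gt (max N m)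
      obtain ⟨k, hk⟩ := hr n
      have : ¬ n < m := by omega
      exact ⟨graft a m fun _ => k, hm _, n, hnA, by omega, by simpa [graft, this] using hk⟩
  filter_upwards [eventually_countable_forall.2 key] with f hf
  refine infinite_of_not_bddAbove ?_
  rintro ⟨N, hN⟩
  obtain ⟨n, hnA, hNn, hn⟩ := hf N
  exact (hN ⟨hnA, hn⟩).not_gt hNn

theorem EverywhereNonmeager.exists_mem_apply {L : Set (ℕ → ℕ)} (hL : EverywhereNonmeager L)
    {n m : ℕ} (hnm : n ≠ m) (j k : ℕ) : ∃ x ∈ L, x n = j ∧ x m = k := by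
  have hO : IsOpen {x : ℕ → ℕ | x n = j ∧ x m = k} :=
    ((isOpen_discrete ({j} : Set ℕ)).preimage
      (continuous_apply (A := fun _ : ℕ => ℕ) n)).inter
      ((isOpen_discrete ({k} : Set ℕ)).preimage (continuous_apply (A := fun _ : ℕ => ℕ) m))
  obtain ⟨x, hx, hxO, -⟩ := hL.exists_mem hO
    ⟨Function.update (fun _ => j) m k, by simp [Function.update_of_ne hnm]⟩
    (Eventually.of_forall fun _ => trivial)
  exact ⟨x, hx, hxO⟩

/-- An everywhere nonmeager subset of the Baire space does not satisfy `U_fin(Γ, T)`. -/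
theorem EverywhereNonmeager.not_ufin {L : Set (ℕ → ℕ)} (hL : EverywhereNonmeager L) :
    ¬ Ufin (OpenGamma L) (OpenTau L) := by
  intro hU
  set C : ℕ → ℕ → Set L := fun n m => {x | x.1 n < m} with hC
  have hCne : ∀ n m, C n m ≠ univ := by
    intro n m h
    obtain ⟨x, hx, hxn, -⟩ := hL.exists_mem_apply n.succ_ne_self.symm m 0
    have : (⟨x, hx⟩ : L) ∈ C n m := h ▸ mem_univ _
    simp [hC, hxn] at this
  have hCmono : ∀ n, Monotone (C n) := fun n a b hab x hx => lt_of_lt_of_le hx hab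
  have hCopen : ∀ n m, IsOpen (C n m) := fun n m =>
    (isOpen_discrete {k : ℕ | k < m}).preimage
      ((continuous_apply (A := fun _ : ℕ => ℕ) n).comp continuous_subtype_val)
  have hCinj : ∀ n, Function.Injective (C n) := by
    refine fun n => (strictMono_nat_of_lt_succ fun m => ?_).injective
    refine (hCmono n m.le_succ).lt_of_not_ge fun h => ?_
    obtain ⟨x, hx, hxn, -⟩ := hL.exists_mem_apply n.succ_ne_self.symm m 0
    have : (⟨x, hx⟩ : L) ∈ C n m := h (by simp [hC, hxn])
    simp [hC, hxn] at this
  have hfin : ∀ n, ∀ F ⊆ range (C n), F.Finite → ∃ m, ⋃₀ F = C n m := by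
    intro n F hF hFf
    obtain ⟨s, hs, rfl⟩ := (Set.subset_range_iff_exists_image_eq.1 hF)
    have hsf : s.Finite := hFf.of_finite_image (hCinj n).injOn
    rcases s.eq_empty_or_nonempty with rfl | hne
    · exact ⟨0, by ext x; simp [hC]⟩
    · obtain ⟨m, hm, hmax⟩ := exists_max_image s id hsf hne
      refine ⟨m, Subset.antisymm ?_ (subset_sUnion_of_mem (mem_image_of_mem _ hm))⟩
      exact sUnion_subset (forall_mem_image.2 fun k hk => hCmono n (hmax k hk))
  obtain ⟨F, hF, hFT⟩ := hU (fun n => range (C n)) (fun n => by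
      refine ⟨countable_range _, forall_mem_range.2 (hCopen n), ⟨?_, ?_⟩,
        infinite_range_of_injective (hCinj n), fun x => ?_⟩
      · refine eq_univ_of_forall fun x => ⟨_, ⟨x.1 n + 1, rfl⟩, ?_⟩
        simp [hC]
      · rintro ⟨m, hm⟩
        exact hCne n m hm
      · refine ((finite_Iic (x.1 n)).image (C n)).subset ?_
        rintro _ ⟨⟨m, rfl⟩, hm⟩
        exact ⟨m, by simpa [hC] using hm, rfl⟩)
    (fun n F hF hFf h => by
      obtain ⟨m, hm⟩ := hfin n F hF hFf
      exact hCne n m (hm ▸ h))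
  choose g hg using fun n => hfin n (F n) (hF n).1 (hF n).2
  obtain ⟨-, -, ⟨⟨-, hlarge⟩, htau⟩⟩ := hFT
  have hrange : range (fun n => ⋃₀ F n) = range fun n => C n (g n) := by simp [hg]
  rw [hrange] at hlarge htau
  -- Indices with `g n = 0` contribute only the empty set.
  set A : Set ℕ := {n | 0 < g n} with hA
  have hAinf : A.Infinite := by
    intro hAf
    obtain ⟨x, hx, -⟩ := hL.exists_mem_apply zero_ne_one 0 0
    refine hlarge ⟨x, hx⟩ ((hAf.image fun n => C n (g n)).subset ?_)
    rintro _ ⟨⟨n, rfl⟩, hn⟩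
    exact ⟨n, (Nat.zero_le _).trans_lt hn, rfl⟩
  -- The τ-condition counts members, not indices; injectivity on `A` turns infinitely many indices
  -- into infinitely many members.
  have hinj : InjOn (fun n => C n (g n)) A := by
    intro n hn m hm hnm
    by_contra hne
    obtain ⟨x, hx, hxn, hxm⟩ := hL.exists_mem_apply hne 0 (g m)
    have h1 : (⟨x, hx⟩ : L) ∈ C n (g n) := by simpa [hC, hxn, hA] using hn
    rw [show C n (g n) = C m (g m) from hnm] at h1
    simp [hC, hxm] at h1
  have hsep : ∀ x y : L, {n ∈ A | x.1 n < g n ∧ g n ≤ y.1 n}.Infinite →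
      {V ∈ range fun n => C n (g n) | ¬ (x ∈ V → y ∈ V)}.Infinite := by
    intro x y h
    refine (h.image (hinj.mono (sep_subset _ _))).mono ?_
    rintro _ ⟨n, ⟨-, hx, hy⟩, rfl⟩
    exact ⟨⟨n, rfl⟩, by simpa [hC] using ⟨hx, hy⟩⟩
  obtain ⟨x, hx, -, hx0, hxg⟩ := hL.exists_mem isOpen_univ univ_nonempty
    ((eventually_residual_frequently hAinf (r := fun _ k => k = 0) fun _ => ⟨0, rfl⟩).and
      (eventually_residual_frequently hAinf (r := fun n k => g n ≤ k) fun n => ⟨g n, le_rfl⟩))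
  -- `y` is generic relative to `x`: infinitely often large where `x` vanishes, and zero where `x`
  -- is large.
  obtain ⟨y, hy, -, hyg, hy0⟩ := hL.exists_mem isOpen_univ univ_nonempty
    ((eventually_residual_frequently hx0 (r := fun n k => g n ≤ k) fun n => ⟨g n, le_rfl⟩).and
      (eventually_residual_frequently hxg (r := fun _ k => k = 0) fun _ => ⟨0, rfl⟩))
  rcases htau ⟨x, hx⟩ ⟨y, hy⟩ with h | h
  · refine hsep _ _ (hyg.mono ?_) h
    rintro n ⟨⟨hnA, h0⟩, hle⟩
    exact ⟨hnA, h0.trans_lt hnA, hle⟩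
  · refine hsep _ _ (hy0.mono ?_) h
    rintro n ⟨⟨hnA, hle⟩, h0⟩
    exact ⟨hnA, h0.trans_lt hnA, hle⟩

end NotUfin

/-! ### The transfinite construction -/

section Construction

theorem exists_forall_transfinite {I X : Type*} [LinearOrder I] [WellFoundedLT I]
    [Nonempty X] (P : I → (I → X) → X → Prop)
    (hloc : ∀ a p q, (∀ b < a, p b = q b) → ∀ y, P a p y → P a q y)
    (hex : ∀ a p, ∃ y, P a p y) : ∃ x : I → X, ∀ a, P a x (x a) := by
  classical
  choose F hF using hex
  let G : ∀ a : I, (∀ b, b < a → X) → X := fun a f =>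
    F a fun b => if h : b < a then f b h else Classical.arbitrary X
  let x : I → X := (wellFounded_lt (α := I)).fix G
  refine ⟨x, fun a => ?_⟩
  have hx : x a = G a fun b _ => x b := (wellFounded_lt (α := I)).fix_eq G a
  rw [hx]
  refine hloc a _ x (fun b hb => ?_) _ (hF a _)
  simp [hb]

theorem mk_borel_le : #{s : Set (ℕ → ℕ) // MeasurableSet[borel (ℕ → ℕ)] s} ≤ 𝔠 := by
  have h := MeasurableSpace.cardinal_measurableSet_le_continuum
    (s := countableBasis (ℕ → ℕ)) ((countable_countableBasis _).le_aleph0.trans Cardinal.aleph0_le_continuum)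
  rwa [← (isBasis_countableBasis (ℕ → ℕ)).borel_eq_generateFrom] at h

/-- The tasks of the transfinite construction: a basic open set, a meager Borel set, and a
sequence of countable families of Borel sets. -/
abbrev Task : Type :=
  countableBasis (ℕ → ℕ) ×
    {s : {s : Set (ℕ → ℕ) // MeasurableSet[borel (ℕ → ℕ)] s} // IsMeagre s.1} ×
    (ℕ → ℕ → {s : Set (ℕ → ℕ) // MeasurableSet[borel (ℕ → ℕ)] s})

theorem mk_task_le : #Task ≤ 𝔠 := by
  have h1 : #(countableBasis (ℕ → ℕ)) ≤ 𝔠 :=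
    Cardinal.mk_le_aleph0.trans Cardinal.aleph0_le_continuum
  have h2 := (Cardinal.mk_subtype_le
    fun s : {s : Set (ℕ → ℕ) // MeasurableSet[borel (ℕ → ℕ)] s} => IsMeagre s.1).trans mk_borel_le
  have h3 : #(ℕ → ℕ → {s : Set (ℕ → ℕ) // MeasurableSet[borel (ℕ → ℕ)] s}) ≤ 𝔠 := by
    simp only [Cardinal.mk_pi, Cardinal.prod_const, Cardinal.mk_nat, Cardinal.lift_id]
    calc _ ≤ (𝔠 ^ ℵ₀) ^ ℵ₀ :=
          Cardinal.power_le_power_right (Cardinal.power_le_power_right mk_borel_le)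
      _ = 𝔠 := by simp
  simp only [Task, Cardinal.mk_prod, Cardinal.lift_id]
  calc _ ≤ 𝔠 * (𝔠 * 𝔠) := mul_le_mul' h1 (mul_le_mul' h2 h3)
    _ = 𝔠 := by simp

theorem exists_borel_meager_superset {M : Set (ℕ → ℕ)} (hM : IsMeagre M) :
    ∃ s, M ⊆ s ∧ MeasurableSet[borel (ℕ → ℕ)] s ∧ IsMeagre s := by
  obtain ⟨t, ht, hG, hd⟩ := mem_residual.1 hM
  refine ⟨tᶜ, subset_compl_comm.1 ht, ?_, ?_⟩
  · borelize (ℕ → ℕ)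
    exact hG.measurableSet.compl
  · rw [IsMeagre, compl_compl]
    exact mem_residual.2 ⟨t, subset_rfl, hG, hd⟩

theorem mk_finset_lt {α : Type} {κ : Cardinal} (hκ : ℵ₀ < κ) (h : #α < κ) : #(Finset α) < κ := by
  classical
  exact (Cardinal.mk_le_of_surjective (List.toFinset_surjective (α := α))).trans_lt
    ((Cardinal.mk_list_le_max α).trans_lt (max_lt hκ h))

theorem exists_everywhereNonmeager_lusin (hcov : covMeager (ℕ → ℕ) = 𝔠) :
    ∃ L : Set (ℕ → ℕ), EverywhereNonmeager L ∧ IsLusin 𝔠 L ∧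
      ∀ U : ℕ → ℕ → Set (ℕ → ℕ), (∀ n k, MeasurableSet[borel (ℕ → ℕ)] (U n k)) →
        (∀ F : Set (ℕ → ℕ), F.Finite → F ⊆ L → ∀ n, IsFatOver (U n) F) →
        ∃ f : ℕ → ℕ, ∀ F : Set (ℕ → ℕ), F.Finite → F ⊆ L →
          IsFatOver (fun n => U n (f n)) F := by
  classical
  obtain ⟨t₀⟩ : Nonempty Task := by
    obtain ⟨o, ho, -⟩ := (isBasis_countableBasis (ℕ → ℕ)).exists_subset_of_mem_open
      (mem_univ 0) isOpen_univ
    exact ⟨⟨o, ho⟩, ⟨⟨∅, @MeasurableSet.empty _ (borel _)⟩, IsMeagre.empty⟩,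
      fun _ _ => ⟨∅, @MeasurableSet.empty _ (borel _)⟩⟩
  have : Nonempty Task := ⟨t₀⟩
  let I : Type := (𝔠 : Cardinal.{0}).ord.ToType
  have hI : #I = 𝔠 := by simp [I]
  have hc : ℵ₀ < covMeager (ℕ → ℕ) := hcov ▸ Cardinal.aleph0_lt_continuum
  have hIio : ∀ a : I, #(Iio a) < 𝔠 := fun a => by simpa [I] using Cardinal.mk_Iio_lt a
  have hIic : ∀ a : I, #(Iic a) < 𝔠 := by
    intro a
    rw [← Iio_insert]
    refine (Cardinal.mk_insert_le).trans_lt ?_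
    exact Cardinal.add_lt_of_lt Cardinal.aleph0_le_continuum (hIio a)
      (Cardinal.one_lt_aleph0.trans Cardinal.aleph0_lt_continuum)
  obtain ⟨task, htask⟩ : ∃ t : I → Task, Function.Surjective t := by
    obtain ⟨e⟩ : Nonempty (Task ↪ I) := Cardinal.le_def _ _ |>.1 (hI.symm ▸ mk_task_le)
    exact ⟨Function.invFun e, Function.invFun_surjective e.injective⟩
  let U : I → ℕ → ℕ → Set (ℕ → ℕ) := fun a n k => ((task a).2.2 n k).1
  have hUm : ∀ a n k, MeasurableSet[borel (ℕ → ℕ)] (U a n k) := fun a n k => ((task a).2.2 n k).2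
  -- The selector for task `b` depends only on points before `b`, so it is available at every stage
  -- `a ≥ b`. The value `0` is a dummy for tasks not fat over those points.
  have hsel : ∀ b (r : Iio b → (ℕ → ℕ)), ∃ f : ℕ → ℕ,
      (∀ (s : Finset (Iio b)) n, IsFatOver (U b n) (r '' s)) →
      ∀ s : Finset (Iio b), IsFatOver (fun n => U b n (f n)) (r '' s) := by
    intro b r
    by_cases h : ∀ (s : Finset (Iio b)) n, IsFatOver (U b n) (r '' s)
    · obtain ⟨f, hf⟩ := exists_selector_isFatOver
        (mk_finset_lt hc ((hIio b).trans_eq hcov.symm)) hc h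
      exact ⟨f, fun _ => hf⟩
    · exact ⟨0, fun h' => absurd h' h⟩
  choose sel hsel using hsel
  let V : I → (I → (ℕ → ℕ)) → ℕ → Set (ℕ → ℕ) :=
    fun b p n => U b n (sel b (fun i => p i) n)
  obtain ⟨x, hx⟩ := exists_forall_transfinite (I := I) (X := ℕ → ℕ)
    (fun a p y => y ∈ (task a).1.1 ∧ ∀ b ≤ a, ∀ s : Finset (Iio a),
      y ∉ (task b).2.1.1.1 ∧ (b < a → y ≠ p b) ∧
      (IsFatOver (V b p) ((fun i : Iio a => p i) '' s) →
        IsFatOver (V b p) (insert y ((fun i : Iio a => p i) '' s))))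
    (by
      rintro a p q hpq y ⟨h1, h2⟩
      refine ⟨h1, fun b hb s => ?_⟩
      have e1 : (fun i : Iio a => p i) = fun i : Iio a => q i := funext fun i => hpq i i.2
      have e2 : V b p = V b q := by
        have : (fun i : Iio b => p i) = fun i : Iio b => q i :=
          funext fun i => hpq i (lt_of_lt_of_le i.2 hb)
        simp only [V, this]
      obtain ⟨h3, h4, h5⟩ := h2 b hb s
      exact ⟨h3, fun hlt => hpq b hlt ▸ h4 hlt, e1 ▸ e2 ▸ h5⟩)
    (by
      intro a p
      have hcard : #(Iic a × Finset (Iio a)) < covMeager (ℕ → ℕ) := by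
        rw [Cardinal.mk_prod, Cardinal.lift_id, Cardinal.lift_id]
        exact Cardinal.mul_lt_of_lt hc.le ((hIic a).trans_eq hcov.symm) (mk_finset_lt hc ((hIio a).trans_eq hcov.symm))
      obtain ⟨y, hyO, hy⟩ := exists_mem_forall_of_residual hcard
        (p := fun (j : Iic a × Finset (Iio a)) y => y ∉ (task j.1).2.1.1.1 ∧
          ((j.1 : I) < a → y ≠ p j.1) ∧
          (IsFatOver (V j.1 p) ((fun i : Iio a => p i) '' j.2) →
            IsFatOver (V j.1 p) (insert y ((fun i : Iio a => p i) '' j.2))))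
        (by
          rintro ⟨⟨b, hb⟩, s⟩
          refine Eventually.and (task b).2.1.2 (Eventually.and ?_ ?_)
          · filter_upwards [isMeagre_singleton_baire (p b)] with y hy _
            exact hy
          · by_cases h : IsFatOver (V b p) ((fun i : Iio a => p i) '' s)
            · filter_upwards [h.eventually_insert fun n => hUm _ _ _] with y hy _
              exact hy
            · exact Eventually.of_forall fun _ h' => absurd h' h)
        ((isBasis_countableBasis _).isOpen (task a).1.2)
        (nonempty_of_mem_countableBasis (task a).1.2)
      exact ⟨y, hyO, fun b hb s => hy (⟨b, hb⟩, s)⟩)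
  have hxne : Function.Injective x := by
    have hlt : ∀ b a : I, b < a → x a ≠ x b := fun b a hba => ((hx a).2 b hba.le ∅).2.1 hba
    intro a b hab
    by_contra hne
    rcases lt_or_gt_of_ne hne with h | h
    · exact hlt _ _ h hab.symm
    · exact hlt _ _ h hab
  have hxM : ∀ {a b}, b ≤ a → x a ∉ (task b).2.1.1.1 := fun hba => ((hx _).2 _ hba ∅).1
  refine ⟨range x, ?_, ⟨?_, ?_⟩, ?_⟩
  · intro O hO ⟨w, hw⟩ hM
    obtain ⟨o, ho, -, hoO⟩ := (isBasis_countableBasis _).exists_subset_of_mem_open hw hO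
    obtain ⟨s, hMs, hsB, hsM⟩ := exists_borel_meager_superset hM
    obtain ⟨a, ha⟩ := htask (⟨o, ho⟩, ⟨⟨s, hsB⟩, hsM⟩, fun _ _ => ⟨s, hsB⟩)
    have h1 := (hx a).1
    have h2 := hxM (le_refl a)
    rw [ha] at h1 h2
    exact h2 (hMs ⟨mem_range_self a, hoO h1⟩)
  · rw [Cardinal.mk_range_eq x hxne, hI]
  · intro M hM
    obtain ⟨s, hMs, hsB, hsM⟩ := exists_borel_meager_superset hM
    obtain ⟨a, ha⟩ := htask (t₀.1, ⟨⟨s, hsB⟩, hsM⟩, fun _ _ => ⟨s, hsB⟩)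
    refine lt_of_le_of_lt ?_ (hIio a)
    refine le_trans (Cardinal.mk_le_mk_of_subset ?_) (Cardinal.mk_image_le (f := x) (s := Iio a))
    rintro _ ⟨⟨b, rfl⟩, hb⟩
    refine ⟨b, lt_of_not_ge (α := I) fun hab => ?_, rfl⟩
    have h2 := hxM hab
    rw [ha] at h2
    exact h2 (hMs hb)
  · intro W hW hfat
    obtain ⟨c, hcW⟩ := htask (t₀.1, t₀.2.1, fun n k => ⟨W n k, hW n k⟩)
    have hUW : U c = W := by simp only [U, hcW]
    have himage : ∀ {a : I} {s : Finset I}, (∀ i ∈ s, i < a) →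
        (fun i : Iio a => x i) '' (s.subtype (· ∈ Iio a)) = x '' s := by
      intro a s hs
      ext y
      constructor
      · rintro ⟨i, hi, rfl⟩
        exact ⟨i, by simpa using hi, rfl⟩
      · rintro ⟨i, hi, rfl⟩
        exact ⟨⟨i, hs i hi⟩, by simpa using hi, rfl⟩
    have hbase : ∀ s : Finset I, (∀ i ∈ s, i < c) → IsFatOver (V c x) (x '' s) := by
      intro s hs
      rw [← himage hs]
      refine hsel c _ (fun t n => ?_) _
      rw [hUW]
      refine hfat _ (t.finite_toSet.image _) ?_ n
      rintro _ ⟨i, -, rfl⟩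
      exact mem_range_self _
    -- Induct by adding the largest index: below `c` the selector was chosen to work, and from `c`
    -- on each new point preserves fatness.
    have hall : ∀ s : Finset I, IsFatOver (V c x) (x '' s) := by
      intro s
      induction s using Finset.induction_on_max with
      | empty => exact hbase ∅ (by simp)
      | insert a s hs ih =>
        rcases lt_or_ge a c with hac | hca
        · refine hbase _ fun i hi => ?_
          rcases Finset.mem_insert.1 hi with rfl | hi
          · exact hac
          · exact (hs i hi).trans hac
        · have := ((hx a).2 c hca (s.subtype (· ∈ Iio a))).2.2
          rw [himage hs] at this
          rw [Finset.coe_insert, image_insert_eq]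
          exact this ih
    refine ⟨sel c fun i => x i, fun F hF hFx => ?_⟩
    obtain ⟨s, rfl⟩ := Set.subset_range_iff_exists_image_eq.1 hFx
    have hs : s.Finite := hF.of_finite_image hxne.injOn
    have := hall hs.toFinset
    rw [hs.coe_toFinset] at this
    simpa only [V, hUW] using this

end Construction

end SelectionPrinciples

theorem mainTheorem10
    (hcov : SelectionPrinciples.covMeager (ℕ → ℕ) = Cardinal.continuum) :
    ∃ L : Set (ℕ → ℕ),
      SelectionPrinciples.IsLusin Cardinal.continuum L ∧
      SelectionPrinciples.S1 (SelectionPrinciples.BorelOmega L)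
        (SelectionPrinciples.BorelOmega L) ∧
      ¬ SelectionPrinciples.Ufin (SelectionPrinciples.OpenGamma L)
        (SelectionPrinciples.OpenTau L) := by
  obtain ⟨L, hL, hLusin, hsel⟩ :=
    SelectionPrinciples.exists_everywhereNonmeager_lusin hcov
  exact ⟨L, hLusin, hL.s1_borelOmega hsel, hL.not_ufin⟩
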